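/- **Setting.** Let $Q:\mathbb{R}^n\to\mathbb{R}^n$ be linear, symmetric and positive semidefinite, $b\in\mathbb{R}^n$, $z\in\mathbb{R}^d$, $\alpha>0$, and let $\nabla:\mathbb{R}^n\to\mathbb{R}^{2m}$ be any linear map. Write $p=(p_1,\dots,p_m)\in\mathbb{R}^{2m}$ with $p_i=(p_i^1,p_i^2)\in\mathbb{R}^2$, and let $\|p\|_1=\sum_{i=1}^m(|p_i^1|+|p_i^2|)$ be the anisotropic norm. Consider the Lagrangian $$l(u,p,\lambda)=\tfrac12\langle Qu,u\rangle-\langle u,b\rangle+\tfrac12\|z\|_2^2+\alpha\|p\|_1+\langle\nabla u-p,\lambda\rangle,\qquad (u,p,\lambda)\in\mathbb{R}^n\times\mathbb{R}^{2m}\times\mathbb{R}^{2m},$$ which is convex in $(u,p)$ and concave in $\lambda$. Let $\partial l(u,p,\lambda)$ be the set of all $(u',p',\lambda')$ such that $(u',p')$ is a subgradient of $l(\cdot,\cdot,\lambda)$ at $(u,p)$ and $\lambda'$ is a supergradient of $l(u,p,\cdot)$ at $\lambda$, and define the KKT operator $$T_l(u,p,\lambda)=\{(u',p',\lambda')\mid(u',p',-\lambda')\in\partial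 l(u,p,\lambda)\}.$$ A solution of the KKT system is a point $(\bar u,\bar p,\bar\lambda)$ with $0\in T_l(\bar u,\bar p,\bar\lambda)$. A set-valued map $F:X\rightrightarrows Y$ is *metrically subregular* at $\bar x$ for $\bar y$ if $\bar y\in F(\bar x)$ and there are $\kappa\ge0$ and neighbourhoods $U$ of $\bar x$ and $V$ of $\bar y$ such that $$\mathrm{dist}(x,F^{-1}(\bar y))\le\kappa\,\mathrm{dist}(\bar y,F(x)\cap V)\qquad\text{for all }x\in U,$$ where the distance to the empty set is $+\infty$. **Theorem.** The operator $T_l$ is maximal monotone, and if the KKT system has a solution, then $T_l$ is metrically subregular at every solution $(\bar u,\bar p,\bar\lambda)$ of the KKT system for the origin. In particular, this holds for the anisotropic TV regularized problem $$\min_u\ \tfrac12\|Ku-z\|_2^2+\tfrac\mu2\|\nabla u\|_2^2+\alpha\|\nabla u\|_1$$ over images $u$ on an $M\times N$ pixel grid, where $K$ is linear, $\mu\ge0$, $\alpha>0$, and $\nabla=(\nabla_1,\nabla_2)$ is the forward difference gradient, $$(\nabla_1u)_{i,j}=u_{i+1,j}-u_{i,j}\ (i<M),\quad(\nabla_1u)_{M,j}=0,\qquad(\nabla_2u)_{i,j}=u_{i,j+1}-u_{i,j}\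 (j<N),\quad(\nabla_2u)_{i,N}=0,$$ with $Q=-\mu\Delta+K^*K$, $\Delta=-\nabla^*\nabla$ and $b=K^*z$ in the Lagrangian; the ROF model is the case $K=I$, $\mu=0$. -/

import Mathlib

/-! ### Set-valued mappings -/

/-- `F : X ⇉ Y` is metrically subregular at `x₀` for `y₀`: `(x₀, y₀)` lies in the graph of `F` and,
for some modulus `c ≥ 0` and some neighbourhoods `U` of `x₀` and `V` of `y₀`,
`dist (x, F⁻¹(y₀)) ≤ c * dist (y₀, F(x) ∩ V)` for all `x ∈ U`.
Distances to sets take values in `[0, ∞]`, so that the distance to the empty set is `∞`. -/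
def MetricallySubregular {X Y : Type*} [PseudoEMetricSpace X] [PseudoEMetricSpace Y]
    (F : X → Set Y) (x₀ : X) (y₀ : Y) : Prop :=
  y₀ ∈ F x₀ ∧
    ∃ c : NNReal, ∃ U ∈ nhds x₀, ∃ V ∈ nhds y₀, ∀ x ∈ U,
      Metric.infEDist x {x' | y₀ ∈ F x'} ≤ c * Metric.infEDist y₀ (F x ∩ V)

/-- `T : E ⇉ E` is a maximal monotone operator: it is monotone, and every pair that is
monotonically related to its graph belongs to its graph. -/
def IsMaximalMonotone {E : Type*} [NormedAddCommGroup E] [InnerProductSpace ℝ E]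
    (T : E → Set E) : Prop :=
  (∀ x y, ∀ x' ∈ T x, ∀ y' ∈ T y, 0 ≤ inner ℝ (x' - y') (x - y)) ∧
    ∀ x x', (∀ y, ∀ y' ∈ T y, 0 ≤ inner ℝ (x' - y') (x - y)) → x' ∈ T x

/-! ### Subdifferentials -/

/-- The subdifferential of a convex function at `x`. -/
def convexSubdifferential {E : Type*} [NormedAddCommGroup E] [InnerProductSpace ℝ E]
    (f : E → ℝ) (x : E) : Set E :=
  {v | ∀ y, f x + inner ℝ v (y - x) ≤ f y}

/-- The subdifferential (set of supergradients) of a concave function at `x`. -/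
def concaveSubdifferential {E : Type*} [NormedAddCommGroup E] [InnerProductSpace ℝ E]
    (f : E → ℝ) (x : E) : Set E :=
  {v | ∀ y, f y ≤ f x + inner ℝ v (y - x)}

/-- The subdifferential `∂l(w, q)` of a convex-concave function `l`: the pairs `(w', q')` with
`w'` a subgradient of the convex function `l(·, q)` at `w` and `q'` a supergradient of the concave
function `l(w, ·)` at `q`. -/
def saddleSubdifferential {E F : Type*} [NormedAddCommGroup E] [InnerProductSpace ℝ E]
    [NormedAddCommGroup F] [InnerProductSpace ℝ F] (l : E → F → ℝ) (x : WithLp 2 (E × F)) :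
    Set (WithLp 2 (E × F)) :=
  {x' | x'.fst ∈ convexSubdifferential (fun w => l w x.snd) x.fst ∧
    x'.snd ∈ concaveSubdifferential (fun q => l x.fst q) x.snd}

/-- The operator `{(w', q') | (w', -q') ∈ ∂l(w, q)}` of a convex-concave function `l`. -/
def saddleOperator {E F : Type*} [NormedAddCommGroup E] [InnerProductSpace ℝ E]
    [NormedAddCommGroup F] [InnerProductSpace ℝ F] (l : E → F → ℝ) (x : WithLp 2 (E × F)) :
    Set (WithLp 2 (E × F)) :=
  {x' | WithLp.toLp 2 (x'.fst, -x'.snd) ∈ saddleSubdifferential l x}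

/-! ### The anisotropic TV Lagrangian -/

/-- The image space, for pixels indexed by `ι`. -/
abbrev ImageSpace (ι : Type*) := EuclideanSpace ℝ ι

/-- The space of fields with two components at each index in `κ`. -/
abbrev FieldSpace (κ : Type*) := EuclideanSpace ℝ (κ × Fin 2)

/-- The space of the primal variables `(u, p)`, with the Euclidean norm. -/
abbrev PrimalSpace (ι κ : Type*) := WithLp 2 (ImageSpace ι × FieldSpace κ)

/-- The space of the triples `((u, p), lam)`, with the Euclidean norm. -/
abbrev KKTSpace (ι κ : Type*) := WithLp 2 (PrimalSpace ι κ × FieldSpace κ)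

/-- The anisotropic norm `‖p‖₁ = ∑ᵢ (|pᵢ¹| + |pᵢ²|)`. -/
def anisotropicNorm {κ : Type*} [Fintype κ] (p : FieldSpace κ) : ℝ :=
  ∑ i, (|p (i, 0)| + |p (i, 1)|)

/-- The Lagrangian
`l(u, p, lam) = ⟨Q u, u⟩ / 2 - ⟨u, b⟩ + ‖z‖² / 2 + α ‖p‖₁ + ⟨G u - p, lam⟩`. -/
noncomputable def tvLagrangian {ι κ τ : Type*} [Fintype ι] [Fintype κ] [Fintype τ]
    (Q : ImageSpace ι →ₗ[ℝ] ImageSpace ι) (b : ImageSpace ι) (z : ImageSpace τ) (α : ℝ)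
    (G : ImageSpace ι →ₗ[ℝ] FieldSpace κ) (w : PrimalSpace ι κ) (lam : FieldSpace κ) : ℝ :=
  (1 / 2) * inner ℝ (Q w.fst) w.fst - inner ℝ w.fst b + (1 / 2) * ‖z‖ ^ 2
    + α * anisotropicNorm w.snd + inner ℝ (G w.fst - w.snd) lam

/-- The KKT operator
`T_l(u, p, lam) = {(u', p', lam') | (u', p', -lam') ∈ ∂l(u, p, lam)}`. -/
noncomputable def kktOperator {ι κ τ : Type*} [Fintype ι] [Fintype κ] [Fintype τ]
    (Q : ImageSpace ι →ₗ[ℝ] ImageSpace ι) (b : ImageSpace ι) (z : ImageSpace τ) (α : ℝ)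
    (G : ImageSpace ι →ₗ[ℝ] FieldSpace κ) : KKTSpace ι κ → Set (KKTSpace ι κ) :=
  saddleOperator (tvLagrangian Q b z α G)

/-! ### The discrete image model on an `M × N` grid -/

/-- The pixels of an `M × N` image (counted from `0`). -/
abbrev Pixel (M N : ℕ) := Fin M × Fin N

/-- Forward difference in the first direction, `0` on the last row. -/
noncomputable def forwardDiff₁ {M N : ℕ} (u : ImageSpace (Pixel M N)) (x : Pixel M N) : ℝ :=
  if h : x.1.val + 1 < M then u (⟨x.1.val + 1, h⟩, x.2) - u x else 0

/-- Forward difference in the second direction, `0` on the last column. -/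
noncomputable def forwardDiff₂ {M N : ℕ} (u : ImageSpace (Pixel M N)) (x : Pixel M N) : ℝ :=
  if h : x.2.val + 1 < N then u (x.1, ⟨x.2.val + 1, h⟩) - u x else 0

/-- The discrete gradient `∇ u = (∇₁ u, ∇₂ u)`. -/
noncomputable def discreteGradient (M N : ℕ) :
    ImageSpace (Pixel M N) →ₗ[ℝ] FieldSpace (Pixel M N) where
  toFun u := WithLp.toLp 2 fun k => if k.2 = 0 then forwardDiff₁ u k.1 else forwardDiff₂ u k.1
  map_add' u v := by
    ext k
    simp only [forwardDiff₁, forwardDiff₂, PiLp.add_apply]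
    split_ifs <;> ring
  map_smul' c u := by
    ext k
    simp only [forwardDiff₁, forwardDiff₂, PiLp.smul_apply, smul_eq_mul, RingHom.id_apply]
    split_ifs <;> ring

/-- The discrete divergence `div = -∇*`. -/
noncomputable def discreteDiv (M N : ℕ) :
    FieldSpace (Pixel M N) →ₗ[ℝ] ImageSpace (Pixel M N) :=
  -LinearMap.adjoint (discreteGradient M N)

/-- The discrete Laplacian `Δ = div ∇`. -/
noncomputable def discreteLaplacian (M N : ℕ) :
    ImageSpace (Pixel M N) →ₗ[ℝ] ImageSpace (Pixel M N) :=
  discreteDiv M N ∘ₗ discreteGradient M N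

/-- The operator `H = -μ Δ + K* K`. -/
noncomputable def tvHessian {M N : ℕ} {τ : Type*} [Fintype τ] (μ : ℝ)
    (K : ImageSpace (Pixel M N) →ₗ[ℝ] ImageSpace τ) :
    ImageSpace (Pixel M N) →ₗ[ℝ] ImageSpace (Pixel M N) :=
  -μ • discreteLaplacian M N + LinearMap.adjoint K ∘ₗ K

/-! Membership in `kktOperator` splits into two affine equations and, for each coordinate `k`, the
condition that `p k` and `p' k + lam k` form a pair in the graph of the subdifferential of `α |·|`
(`mem_kktOperator_iff`).

Monotonicity: the terms in `G` are skew and cancel, which leaves the form of `Q` and the monotone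
scalar graphs. Maximality: testing against graph points that differ from `x` in a single block or
coordinate recovers each condition separately.

Subregularity: each scalar graph is a union of three polyhedra, so the graph of the operator is a
finite union of polyhedra. On one piece, a value `x'` at `x` perturbs a linear system by at most
`‖x'‖`, and Hoffman's bound gives a solution within a multiple of `‖x'‖`. Near the reference pair
only pieces containing it are met, so the reference solution makes the system of each such piece
consistent. The largest of the finitely many constants serves as modulus. -/

open Filter Topology

/-! ### Hoffman's error bound, by minimizing a penalized violation -/

theorem exists_pos_slope {V I : Type*} [NormedAddCommGroup V] [NormedSpace ℝ V]
    (a : I → V →ₗ[ℝ] ℝ) (J P : Finset I) (hP : P.Nonempty) :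
    ∃ s : ℝ, 0 < s ∧ ((∃ d, (∀ i ∈ J, a i d ≤ 0) ∧ ∀ i ∈ P, a i d < 0) →
      ∃ d, d ≠ 0 ∧ (∀ i ∈ J, a i d ≤ 0) ∧ ∑ i ∈ P, a i d ≤ -(s * ‖d‖)) := by
  by_cases h : ∃ d, (∀ i ∈ J, a i d ≤ 0) ∧ ∀ i ∈ P, a i d < 0
  · obtain ⟨d, hJ, hd⟩ := h
    have hneg : ∑ i ∈ P, a i d < 0 := Finset.sum_neg hd hP
    have hd0 : d ≠ 0 := by
      rintro rfl
      simp at hneg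
    have hn : 0 < ‖d‖ := norm_pos_iff.mpr hd0
    refine ⟨-(∑ i ∈ P, a i d) / ‖d‖, div_pos (by linarith) hn, fun _ => ⟨d, hd0, hJ, ?_⟩⟩
    rw [div_mul_cancel₀ _ hn.ne', neg_neg]
  · exact ⟨1, one_pos, fun h' => absurd h' h⟩

/-- **Hoffman's error bound** for a finite system of linear inequalities. -/
theorem exists_error_bound_of_le {V I : Type*} [NormedAddCommGroup V] [NormedSpace ℝ V]
    [FiniteDimensional ℝ V] [Fintype I] (a : I → V →ₗ[ℝ] ℝ) (β : I → ℝ) :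
    ∃ c : ℝ, 0 ≤ c ∧ ∀ z, (∀ i, a i z ≤ β i) → ∀ x, ∃ y, (∀ i, a i y ≤ β i) ∧
      ‖x - y‖ ≤ c * ∑ i, max (a i x - β i) 0 := by
  classical
  have hslope : ∃ ε : ℝ, 0 < ε ∧ ∀ J P : Finset I, P.Nonempty →
      (∃ d, (∀ i ∈ J, a i d ≤ 0) ∧ ∀ i ∈ P, a i d < 0) →
      ∃ d, d ≠ 0 ∧ (∀ i ∈ J, a i d ≤ 0) ∧ ∑ i ∈ P, a i d < -(ε * ‖d‖) := by
    have h : ∀ q : Finset I × Finset I, ∃ s : ℝ, 0 < s ∧ (q.2.Nonempty →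
        (∃ d, (∀ i ∈ q.1, a i d ≤ 0) ∧ ∀ i ∈ q.2, a i d < 0) →
        ∃ d, d ≠ 0 ∧ (∀ i ∈ q.1, a i d ≤ 0) ∧ ∑ i ∈ q.2, a i d ≤ -(s * ‖d‖)) := by
      intro q
      by_cases hq : q.2.Nonempty
      · obtain ⟨s, hs, h⟩ := exists_pos_slope a q.1 q.2 hq
        exact ⟨s, hs, fun _ => h⟩
      · exact ⟨1, one_pos, fun h' => absurd h' hq⟩
    choose s hs h using h
    -- There are finitely many pairs `(J, P)`, so one slope serves all of them; halving it makes the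
    -- inequality strict.
    obtain ⟨q₀, hq₀⟩ := Finite.exists_min s
    refine ⟨s q₀ / 2, half_pos (hs q₀), fun J P hP hd => ?_⟩
    obtain ⟨d, hd0, hJ, hsum⟩ := h (J, P) hP hd
    refine ⟨d, hd0, hJ, hsum.trans_lt ?_⟩
    have hn : 0 < ‖d‖ := norm_pos_iff.mpr hd0
    have := hq₀ (J, P)
    have := hs q₀
    nlinarith
  obtain ⟨ε, hε, hslope⟩ := hslope
  refine ⟨ε⁻¹, (inv_pos.mpr hε).le, fun z hz x => ?_⟩
  have hcont : ∀ i, Continuous (a i) := fun i => (a i).continuous_of_finiteDimensional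
  set g : V → ℝ := fun y => ∑ i, max (a i y - β i) 0 with hg
  have hg0 : ∀ y, 0 ≤ g y := fun y => Finset.sum_nonneg fun i _ => le_max_right _ _
  have hgc : Continuous g :=
    continuous_finsetSum _ fun i _ => ((hcont i).sub continuous_const).max continuous_const
  have : ProperSpace V := FiniteDimensional.proper ℝ V
  -- The distance term makes the objective coercive, so a minimizer exists. It must be feasible:
  -- otherwise a descent direction lowers `g` faster than `ε * dist` can grow.
  obtain ⟨y, hy⟩ := Continuous.exists_forall_le (f := fun y => g y + ε * dist y x)
    (hgc.add (continuous_const.mul (continuous_id.dist continuous_const)))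
    (tendsto_atTop_mono (fun y => le_add_of_nonneg_left (hg0 y))
      ((tendsto_dist_right_cocompact_atTop x).const_mul_atTop hε))
  refine ⟨y, ?_, ?_⟩
  · by_contra! hne
    obtain ⟨i₀, hi₀⟩ := hne
    set P : Finset I := {i | β i < a i y} with hP
    set J : Finset I := {i | a i y = β i} with hJ
    -- Heading for the feasible `z` lowers every violated constraint and raises no active one;
    -- `hslope` trades this direction for one with uniform slope.
    obtain ⟨d, hd0, hdJ, hdP⟩ := hslope J P ⟨i₀, by simpa [hP] using hi₀⟩ ⟨z - y, by
      refine ⟨fun i hi => ?_, fun i hi => ?_⟩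
      · have : a i y = β i := by simpa [hJ] using hi
        have := hz i
        rw [map_sub]; linarith
      · have : β i < a i y := by simpa [hP] using hi
        have := hz i
        rw [map_sub]; linarith⟩
    -- For small `t`, slack constraints stay slack, active ones do not become violated, and violated
    -- ones change linearly.
    have hev : ∀ᶠ t : ℝ in 𝓝[>] 0, ∀ i, max (a i (y + t • d) - β i) 0 ≤
        max (a i y - β i) 0 + t * (if i ∈ P then a i d else 0) := by
      refine eventually_all.mpr fun i => ?_
      have hlim : Tendsto (fun t : ℝ => a i (y + t • d)) (𝓝[>] 0) (𝓝 (a i y)) := by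
        have : Continuous fun t : ℝ => a i (y + t • d) :=
          (hcont i).comp (continuous_const.add (continuous_id.smul continuous_const))
        simpa using (this.tendsto 0).mono_left nhdsWithin_le_nhds
      rcases lt_trichotomy (a i y) (β i) with h | h | h
      · filter_upwards [hlim.eventually_lt_const h] with t ht
        have : i ∉ P := by simp [hP, h.le]
        rw [if_neg this, max_eq_right (by linarith), max_eq_right (by linarith)]
        simp
      · filter_upwards [self_mem_nhdsWithin] with t ht
        have hi : i ∉ P := by simp [hP, h.le]
        have := hdJ i (by simp [hJ, h])
        have ht : 0 < t := ht
        rw [if_neg hi, h, map_add, map_smul, smul_eq_mul, h, max_eq_right (by nlinarith)]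
        simp
      · filter_upwards [hlim.eventually_const_lt h] with t ht
        have hi : i ∈ P := by simp [hP, h]
        rw [if_pos hi, max_eq_left (by linarith), max_eq_left (by linarith), map_add, map_smul,
          smul_eq_mul]
        linarith
    obtain ⟨t, ht, ht0⟩ := (hev.and self_mem_nhdsWithin).exists
    have ht0 : 0 < t := ht0
    have hdec : g (y + t • d) ≤ g y + t * ∑ i ∈ P, a i d := by
      calc g (y + t • d) ≤ ∑ i, (max (a i y - β i) 0 + t * (if i ∈ P then a i d else 0)) :=
            Finset.sum_le_sum fun i _ => ht i
        _ = g y + t * ∑ i ∈ P, a i d := by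
            rw [Finset.sum_add_distrib, ← Finset.mul_sum, Finset.sum_ite_mem, Finset.univ_inter]
    have hdist : dist (y + t • d) x ≤ dist y x + t * ‖d‖ := by
      calc dist (y + t • d) x ≤ dist (y + t • d) y + dist y x := dist_triangle _ _ _
        _ = dist y x + t * ‖d‖ := by
            rw [dist_eq_norm, add_sub_cancel_left, norm_smul, Real.norm_of_nonneg ht0.le, add_comm]
    have := hy (y + t • d)
    have h1 := mul_le_mul_of_nonneg_left hdist hε.le
    have h2 := mul_lt_mul_of_pos_left hdP ht0
    linarith
  · have h := hy x
    simp only [dist_self, mul_zero, add_zero] at h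
    rw [← dist_eq_norm, dist_comm, inv_mul_eq_div, le_div_iff₀ hε, mul_comm]
    linarith [hg0 y]

/-- **Hoffman's error bound** for a finite system of linear equations and inequalities. -/
theorem exists_error_bound_of_eq_of_le {V E I : Type*} [NormedAddCommGroup V] [NormedSpace ℝ V]
    [FiniteDimensional ℝ V] [Fintype E] [Fintype I] (e : E → V →ₗ[ℝ] ℝ) (γ : E → ℝ)
    (a : I → V →ₗ[ℝ] ℝ) (β : I → ℝ) :
    ∃ c : ℝ, 0 ≤ c ∧ ∀ z, (∀ i, e i z = γ i) → (∀ i, a i z ≤ β i) → ∀ x r, 0 ≤ r →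
      (∀ i, |e i x - γ i| ≤ r) → (∀ i, a i x ≤ β i + r) →
      ∃ y, (∀ i, e i y = γ i) ∧ (∀ i, a i y ≤ β i) ∧ ‖x - y‖ ≤ c * r := by
  obtain ⟨c, hc, h⟩ := exists_error_bound_of_le
    (Sum.elim (Sum.elim e fun i => -e i) a) (Sum.elim (Sum.elim γ fun i => -γ i) β)
  -- Each equation becomes two opposite inequalities, and each of the excesses summed is at most
  -- `r`.
  refine ⟨c * Fintype.card ((E ⊕ E) ⊕ I), by positivity, fun z hze hza x r hr hxe hxa => ?_⟩
  obtain ⟨y, hy, hxy⟩ := h z (by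
    rintro ((i | i) | i)
    · exact (hze i).le
    · simp [hze i]
    · exact hza i) x
  refine ⟨y, fun i => le_antisymm (hy (.inl (.inl i))) ?_, fun i => hy (.inr i),
    hxy.trans ?_⟩
  · simpa using hy (.inl (.inr i))
  · rw [mul_assoc]
    refine mul_le_mul_of_nonneg_left ?_ hc
    rw [← nsmul_eq_mul]
    refine Finset.sum_le_card_nsmul _ _ _ ?_
    rintro ((i | i) | i) -
    · exact max_le (le_of_abs_le (hxe i)) hr
    · refine max_le ?_ hr
      have := neg_le_of_abs_le (hxe i)
      simp only [Sum.elim_inl, Sum.elim_inr, LinearMap.neg_apply]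
      linarith
    · refine max_le ?_ hr
      have := hxa i
      simp only [Sum.elim_inr]
      linarith

/-! ### Scalar facts -/

/-- Divide by `t` and let `t` tend to `0`. This extracts first-order conditions from quadratic
perturbations. -/
theorem nonpos_of_forall_mul_le {a b : ℝ} (h : ∀ t : ℝ, 0 < t → t * a ≤ t ^ 2 * b) : a ≤ 0 := by
  by_contra! ha
  have hb : 0 < |b| + 1 := by positivity
  have := h (a / (2 * (|b| + 1))) (by positivity)
  have h1 : a ≤ a / (2 * (|b| + 1)) * b := by
    refine le_of_mul_le_mul_left ?_ (show 0 < a / (2 * (|b| + 1)) by positivity)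
    linarith
  have h2 : a / (2 * (|b| + 1)) * b ≤ a / (2 * (|b| + 1)) * (|b| + 1) :=
    mul_le_mul_of_nonneg_left (by linarith [le_abs_self b]) (by positivity)
  have h3 : a / (2 * (|b| + 1)) * (|b| + 1) = a / 2 := by field_simp
  linarith

theorem eq_zero_of_forall_mul_inner_self_le {E : Type*} [NormedAddCommGroup E]
    [InnerProductSpace ℝ E] {r : E} {b : ℝ} (h : ∀ t : ℝ, 0 < t → t * inner ℝ r r ≤ t ^ 2 * b) :
    r = 0 :=
  inner_self_eq_zero.mp
    (le_antisymm (nonpos_of_forall_mul_le h) real_inner_self_nonneg)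

/-- `s` is a subgradient of `α |·|` at `p`. -/
def IsAbsSubgradient (α p s : ℝ) : Prop :=
  |s| ≤ α ∧ s * p = α * |p|

theorem IsAbsSubgradient.add_mul_sub_le {α p s : ℝ} (h : IsAbsSubgradient α p s) (q : ℝ) :
    α * |p| + s * (q - p) ≤ α * |q| := by
  have h1 : s * q ≤ |s| * |q| := (le_abs_self _).trans (abs_mul s q).le
  have h2 := mul_le_mul_of_nonneg_right h.1 (abs_nonneg q)
  linarith [h.2]

theorem IsAbsSubgradient.sub_mul_sub_nonneg {α p s q t : ℝ} (h : IsAbsSubgradient α p s)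
    (h' : IsAbsSubgradient α q t) : 0 ≤ (s - t) * (p - q) := by
  linarith [h.add_mul_sub_le q, h'.add_mul_sub_le p]

theorem isAbsSubgradient_of_pos {α p : ℝ} (hα : 0 ≤ α) (hp : 0 ≤ p) : IsAbsSubgradient α p α :=
  ⟨(abs_of_nonneg hα).le, by rw [abs_of_nonneg hp]⟩

theorem isAbsSubgradient_of_neg {α p : ℝ} (hα : 0 ≤ α) (hp : p ≤ 0) :
    IsAbsSubgradient α p (-α) :=
  ⟨by rw [abs_neg, abs_of_nonneg hα], by rw [abs_of_nonpos hp]; ring⟩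

theorem exists_isAbsSubgradient {α : ℝ} (hα : 0 ≤ α) (p : ℝ) : ∃ s, IsAbsSubgradient α p s :=
  (le_total 0 p).elim (fun h => ⟨_, isAbsSubgradient_of_pos hα h⟩)
    fun h => ⟨_, isAbsSubgradient_of_neg hα h⟩

/-- Test points on either side of `p`, with slopes `α` and `-α`, confine `s` to `[-α, α]`; the test
point `0` with the slope of the sign of `p` gives `s * p ≥ α * |p|`. -/
theorem isAbsSubgradient_of_forall_mul_nonneg {α p s : ℝ} (hα : 0 ≤ α)
    (h : ∀ q t, IsAbsSubgradient α q t → 0 ≤ (s - t) * (p - q)) : IsAbsSubgradient α p s := by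
  have hp := neg_abs_le p
  have hp' := le_abs_self p
  have h1 := h (|p| + 1) α (isAbsSubgradient_of_pos hα (by positivity))
  have h2 := h (-(|p| + 1)) (-α) (isAbsSubgradient_of_neg hα (by linarith [abs_nonneg p]))
  have h3 : s ≤ α := by nlinarith
  have h4 : -α ≤ s := by nlinarith
  have h5 : |s| ≤ α := abs_le.mpr ⟨h4, h3⟩
  refine ⟨h5, le_antisymm ?_ ?_⟩
  · exact (le_abs_self _).trans ((abs_mul s p).le.trans
      (mul_le_mul_of_nonneg_right h5 (abs_nonneg p)))
  · rcases le_total 0 p with hp0 | hp0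
    · have := h 0 α (isAbsSubgradient_of_pos hα le_rfl)
      rw [abs_of_nonneg hp0]; linarith
    · have := h 0 (-α) (isAbsSubgradient_of_neg hα le_rfl)
      rw [abs_of_nonpos hp0]; linarith

theorem isAbsSubgradient_of_forall_le {α p s : ℝ} (hα : 0 ≤ α)
    (h : ∀ q, α * |p| + s * (q - p) ≤ α * |q|) : IsAbsSubgradient α p s :=
  isAbsSubgradient_of_forall_mul_nonneg hα fun q t ht => by
    linarith [h q, ht.add_mul_sub_le p]

/-! ### Explicit form of the KKT operator -/

theorem anisotropicNorm_eq_sum {κ : Type*} [Fintype κ] (p : FieldSpace κ) :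
    anisotropicNorm p = ∑ k, |p k| := by
  simp [anisotropicNorm, Fintype.sum_prod_type, Fin.sum_univ_two]

theorem real_inner_eq_sum {ι : Type*} [Fintype ι] (x y : EuclideanSpace ℝ ι) :
    inner ℝ x y = ∑ i, x i * y i := by
  simp [PiLp.inner_apply, mul_comm]

section

variable {ι κ τ : Type*} [Fintype ι] [Fintype κ] [Fintype τ]

theorem isAbsSubgradient_of_forall_anisotropicNorm {α : ℝ} (hα : 0 ≤ α) {p s : FieldSpace κ}
    (h : ∀ q, α * anisotropicNorm p + inner ℝ s (q - p) ≤ α * anisotropicNorm q)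
    (k : κ × Fin 2) : IsAbsSubgradient α (p k) (s k) := by
  classical
  refine isAbsSubgradient_of_forall_le hα fun q => ?_
  have h1 := h (WithLp.toLp 2 (Function.update p k q))
  simp only [anisotropicNorm_eq_sum, real_inner_eq_sum, Finset.mul_sum] at h1
  rw [← Finset.sum_add_distrib, ← sub_nonneg, ← Finset.sum_sub_distrib,
    Finset.sum_eq_single k] at h1
  · simpa using h1
  · intro j _ hj
    simp [Function.update_of_ne hj]
  · simp

theorem add_inner_le_anisotropicNorm {α : ℝ} {p s : FieldSpace κ}
    (h : ∀ k, IsAbsSubgradient α (p k) (s k)) (q : FieldSpace κ) :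
    α * anisotropicNorm p + inner ℝ s (q - p) ≤ α * anisotropicNorm q := by
  simp only [anisotropicNorm_eq_sum, real_inner_eq_sum, Finset.mul_sum]
  rw [← Finset.sum_add_distrib]
  exact Finset.sum_le_sum fun k _ => (h k).add_mul_sub_le (q k)

/-- Exact second-order expansion in `u`, the `p` part kept apart; symmetry of `Q` merges the cross
terms. -/
theorem tvLagrangian_sub (Q : ImageSpace ι →ₗ[ℝ] ImageSpace ι) (hQ : Q.IsPositive)
    (b : ImageSpace ι) (z : ImageSpace τ) (α : ℝ) (G : ImageSpace ι →ₗ[ℝ] FieldSpace κ)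
    (w w' : PrimalSpace ι κ) (lam : FieldSpace κ) :
    tvLagrangian Q b z α G w' lam - tvLagrangian Q b z α G w lam =
      inner ℝ (Q w.fst - b + LinearMap.adjoint G lam) (w'.fst - w.fst)
        + (1 / 2) * inner ℝ (Q (w'.fst - w.fst)) (w'.fst - w.fst)
        + (α * anisotropicNorm w'.snd - α * anisotropicNorm w.snd
          - inner ℝ lam (w'.snd - w.snd)) := by
  have h1 : inner ℝ (Q w'.fst) w.fst = inner ℝ (Q w.fst) w'.fst := by
    rw [hQ.isSymmetric, real_inner_comm]
  simp only [tvLagrangian, inner_add_left, inner_sub_left, inner_sub_right, map_sub,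
    LinearMap.adjoint_inner_left, h1]
  rw [real_inner_comm lam (G w'.fst), real_inner_comm lam (G w.fst),
    real_inner_comm lam w'.snd, real_inner_comm lam w.snd,
    real_inner_comm b w'.fst, real_inner_comm b w.fst]
  ring

theorem mem_convexSubdifferential_tvLagrangian_iff {Q : ImageSpace ι →ₗ[ℝ] ImageSpace ι}
    (hQ : Q.IsPositive) (b : ImageSpace ι) (z : ImageSpace τ) {α : ℝ} (hα : 0 ≤ α)
    (G : ImageSpace ι →ₗ[ℝ] FieldSpace κ) (w w' : PrimalSpace ι κ) (lam : FieldSpace κ) :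
    w' ∈ convexSubdifferential (fun w => tvLagrangian Q b z α G w lam) w ↔
      w'.fst = Q w.fst - b + LinearMap.adjoint G lam ∧
        ∀ k, IsAbsSubgradient α (w.snd k) (w'.snd k + lam k) := by
  have key : ∀ y : PrimalSpace ι κ, tvLagrangian Q b z α G w lam + inner ℝ w' (y - w) ≤
      tvLagrangian Q b z α G y lam ↔
      inner ℝ (w'.fst - (Q w.fst - b + LinearMap.adjoint G lam)) (y.fst - w.fst)
        + (α * anisotropicNorm w.snd + inner ℝ (w'.snd + lam) (y.snd - w.snd)) ≤
      (1 / 2) * inner ℝ (Q (y.fst - w.fst)) (y.fst - w.fst) + α * anisotropicNorm y.snd := by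
    intro y
    have := tvLagrangian_sub Q hQ b z α G w y lam
    rw [show inner ℝ w' (y - w) = inner ℝ w'.fst (y - w).fst + inner ℝ w'.snd (y - w).snd from
      WithLp.prod_inner_apply _ _, WithLp.sub_fst, WithLp.sub_snd, inner_sub_left (𝕜 := ℝ) w'.fst,
      inner_add_left (𝕜 := ℝ) w'.snd]
    constructor <;> intro h <;> linarith
  constructor
  · intro h
    have h : ∀ y, _ := fun y => (key y).mp (h y)
    constructor
    -- Moving `u` along the residual itself gains `t ‖r‖²` against a cost quadratic in `t`, so the
    -- residual `r` vanishes.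
    · refine sub_eq_zero.mp (eq_zero_of_forall_mul_inner_self_le
        (b := (1 / 2) * inner ℝ (Q (w'.fst - (Q w.fst - b + LinearMap.adjoint G lam)))
          (w'.fst - (Q w.fst - b + LinearMap.adjoint G lam))) fun t _ => ?_)
      have := h (WithLp.toLp 2
        (w.fst + t • (w'.fst - (Q w.fst - b + LinearMap.adjoint G lam)), w.snd))
      simp only [WithLp.toLp_fst, WithLp.toLp_snd, add_sub_cancel_left, sub_self,
        inner_zero_right, map_smul, real_inner_smul_left, real_inner_smul_right] at this
      linarith
    · refine isAbsSubgradient_of_forall_anisotropicNorm hα (s := w'.snd + lam) fun q => ?_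
      simpa using h (WithLp.toLp 2 (w.fst, q))
  · rintro ⟨h1, h2⟩ y
    refine (key y).mpr ?_
    have h3 := hQ.re_inner_nonneg_left (y.fst - w.fst)
    have h4 := add_inner_le_anisotropicNorm (s := w'.snd + lam) h2 y.snd
    rw [h1, sub_self, inner_zero_left]
    simp only [RCLike.re_to_real] at h3
    linarith

theorem mem_concaveSubdifferential_tvLagrangian_iff (Q : ImageSpace ι →ₗ[ℝ] ImageSpace ι)
    (b : ImageSpace ι) (z : ImageSpace τ) (α : ℝ)
    (G : ImageSpace ι →ₗ[ℝ] FieldSpace κ) (w : PrimalSpace ι κ) (lam lam' : FieldSpace κ) :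
    lam' ∈ concaveSubdifferential (fun q => tvLagrangian Q b z α G w q) lam ↔
      lam' = G w.fst - w.snd := by
  have key : ∀ q, tvLagrangian Q b z α G w q ≤
      tvLagrangian Q b z α G w lam + inner ℝ lam' (q - lam) ↔
      0 ≤ inner ℝ (lam' - (G w.fst - w.snd)) (q - lam) := by
    intro q
    rw [inner_sub_left (𝕜 := ℝ) lam', inner_sub_right (𝕜 := ℝ) (G w.fst - w.snd)]
    simp only [tvLagrangian]
    constructor <;> intro h <;> linarith
  constructor
  · intro h
    have := (key _).mp (h (lam - (lam' - (G w.fst - w.snd))))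
    rw [sub_sub_cancel_left, inner_neg_right, neg_nonneg] at this
    exact sub_eq_zero.mp (inner_self_eq_zero.mp (le_antisymm this real_inner_self_nonneg))
  · rintro h q
    exact (key q).mpr (by rw [h, sub_self, inner_zero_left])

theorem mem_kktOperator_iff {Q : ImageSpace ι →ₗ[ℝ] ImageSpace ι}
    (hQ : Q.IsPositive) (b : ImageSpace ι) (z : ImageSpace τ) {α : ℝ} (hα : 0 ≤ α)
    (G : ImageSpace ι →ₗ[ℝ] FieldSpace κ) (x x' : KKTSpace ι κ) :
    x' ∈ kktOperator Q b z α G x ↔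
      x'.fst.fst = Q x.fst.fst - b + LinearMap.adjoint G x.snd ∧
      (∀ k, IsAbsSubgradient α (x.fst.snd k) (x'.fst.snd k + x.snd k)) ∧
      x'.snd = x.fst.snd - G x.fst.fst := by
  change x'.fst ∈ convexSubdifferential (fun w => tvLagrangian Q b z α G w x.snd) x.fst ∧
    -x'.snd ∈ concaveSubdifferential (fun q => tvLagrangian Q b z α G x.fst q) x.snd ↔ _
  rw [mem_convexSubdifferential_tvLagrangian_iff hQ b z hα,
    mem_concaveSubdifferential_tvLagrangian_iff, and_assoc, neg_eq_iff_eq_neg, neg_sub]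

/-! ### Maximal monotonicity -/

theorem inner_kktSpace (x y : KKTSpace ι κ) :
    inner ℝ x y = inner ℝ x.fst.fst y.fst.fst + inner ℝ x.fst.snd y.fst.snd
      + inner ℝ x.snd y.snd := by
  rw [WithLp.prod_inner_apply, WithLp.prod_inner_apply]
  rfl

theorem kktOperator_monotone {Q : ImageSpace ι →ₗ[ℝ] ImageSpace ι}
    (hQ : Q.IsPositive) (b : ImageSpace ι) (z : ImageSpace τ) {α : ℝ} (hα : 0 ≤ α)
    (G : ImageSpace ι →ₗ[ℝ] FieldSpace κ) {x y x' y' : KKTSpace ι κ}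
    (hx : x' ∈ kktOperator Q b z α G x) (hy : y' ∈ kktOperator Q b z α G y) :
    0 ≤ inner ℝ (x' - y') (x - y) := by
  obtain ⟨hx1, hx2, hx3⟩ := (mem_kktOperator_iff hQ b z hα G x x').mp hx
  obtain ⟨hy1, hy2, hy3⟩ := (mem_kktOperator_iff hQ b z hα G y y').mp hy
  have hq := hQ.re_inner_nonneg_left (x.fst.fst - y.fst.fst)
  simp only [RCLike.re_to_real] at hq
  have hp : 0 ≤ inner ℝ ((x'.fst.snd + x.snd) - (y'.fst.snd + y.snd)) (x.fst.snd - y.fst.snd) := by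
    rw [real_inner_eq_sum]
    exact Finset.sum_nonneg fun k _ => (hx2 k).sub_mul_sub_nonneg (hy2 k)
  have e : inner ℝ (x' - y') (x - y) =
      inner ℝ (Q (x.fst.fst - y.fst.fst)) (x.fst.fst - y.fst.fst) +
      inner ℝ ((x'.fst.snd + x.snd) - (y'.fst.snd + y.snd)) (x.fst.snd - y.fst.snd) := by
    have h1 : x'.fst.fst - y'.fst.fst = Q (x.fst.fst - y.fst.fst)
        + LinearMap.adjoint G (x.snd - y.snd) := by
      rw [hx1, hy1, map_sub, map_sub]; abel
    have h2 : x'.snd - y'.snd = (x.fst.snd - y.fst.snd) - G (x.fst.fst - y.fst.fst) := by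
      rw [hx3, hy3, map_sub]; abel
    have h3 : x'.fst.snd + x.snd - (y'.fst.snd + y.snd) =
        (x'.fst.snd - y'.fst.snd) + (x.snd - y.snd) := by abel
    simp only [inner_kktSpace, WithLp.sub_fst, WithLp.sub_snd, h1, h2, h3]
    rw [inner_add_left, inner_sub_left (𝕜 := ℝ) (x.fst.snd - y.fst.snd),
      inner_add_left (𝕜 := ℝ) (x'.fst.snd - y'.fst.snd), LinearMap.adjoint_inner_left,
      real_inner_comm (x.snd - y.snd) (x.fst.snd - y.fst.snd),
      real_inner_comm (x.snd - y.snd) (G (x.fst.fst - y.fst.fst))]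
    ring
  linarith

theorem kktOperator_isMaximalMonotone {Q : ImageSpace ι →ₗ[ℝ] ImageSpace ι}
    (hQ : Q.IsPositive) (b : ImageSpace ι) (z : ImageSpace τ) {α : ℝ} (hα : 0 ≤ α)
    (G : ImageSpace ι →ₗ[ℝ] FieldSpace κ) : IsMaximalMonotone (kktOperator Q b z α G) := by
  classical
  refine ⟨fun x y x' hx y' hy => kktOperator_monotone hQ b z hα G hx hy, fun x x' h => ?_⟩
  -- The graph is parametrized by `u`, `p`, `lam` and a subgradient field `s`, which can be chosen
  -- freely as tests.
  have hG : ∀ (u : ImageSpace ι) (p s lam : FieldSpace κ),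
      (∀ k, IsAbsSubgradient α (p k) (s k)) →
      0 ≤ inner ℝ (x'.fst.fst - (Q u - b + LinearMap.adjoint G lam)) (x.fst.fst - u)
        + inner ℝ (x'.fst.snd - (s - lam)) (x.fst.snd - p)
        + inner ℝ (x'.snd - (p - G u)) (x.snd - lam) := by
    intro u p s lam hs
    have := h (WithLp.toLp 2 (WithLp.toLp 2 (u, p), lam))
      (WithLp.toLp 2 (WithLp.toLp 2 (Q u - b + LinearMap.adjoint G lam, s - lam), p - G u))
      ((mem_kktOperator_iff hQ b z hα G _ _).mpr ⟨rfl, by simpa using hs, rfl⟩)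
    simpa [inner_kktSpace] using this
  choose s₀ hs₀ using exists_isAbsSubgradient hα
  have hu : x'.fst.fst = Q x.fst.fst - b + LinearMap.adjoint G x.snd := by
    set r := x'.fst.fst - (Q x.fst.fst - b + LinearMap.adjoint G x.snd) with hr
    refine sub_eq_zero.mp (eq_zero_of_forall_mul_inner_self_le (b := inner ℝ (Q r) r)
      fun t _ => ?_)
    have := hG (x.fst.fst + t • r) x.fst.snd (WithLp.toLp 2 fun k => s₀ (x.fst.snd k)) x.snd
      (fun k => hs₀ _)
    have e : x'.fst.fst - (Q (x.fst.fst + t • r) - b + LinearMap.adjoint G x.snd) =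
        r - t • Q r := by
      rw [hr, map_add, map_smul]; abel
    rw [e, sub_self, sub_self, inner_zero_right, inner_zero_right, sub_add_cancel_left,
      inner_neg_right, inner_sub_left, real_inner_smul_left, real_inner_smul_right,
      real_inner_smul_right] at this
    linarith
  have hl : x'.snd = x.fst.snd - G x.fst.fst := by
    have := hG x.fst.fst x.fst.snd (WithLp.toLp 2 fun k => s₀ (x.fst.snd k))
      (x.snd + (x'.snd - (x.fst.snd - G x.fst.fst))) (fun k => hs₀ _)
    rw [sub_self, sub_self, inner_zero_right, inner_zero_right, sub_add_cancel_left,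
      inner_neg_right, zero_add, zero_add, neg_nonneg] at this
    exact sub_eq_zero.mp (inner_self_eq_zero.mp (le_antisymm this real_inner_self_nonneg))
  refine (mem_kktOperator_iff hQ b z hα G x x').mpr ⟨hu, fun k => ?_, hl⟩
  refine isAbsSubgradient_of_forall_mul_nonneg hα fun q t ht => ?_
  have := hG x.fst.fst (WithLp.toLp 2 (Function.update x.fst.snd k q))
    (WithLp.toLp 2 (Function.update (fun j => s₀ (x.fst.snd j)) k t)) x.snd (fun j => by
      rcases eq_or_ne j k with rfl | hj
      · simpa using ht
      · simpa [Function.update_of_ne hj] using hs₀ _)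
  rw [sub_self, inner_zero_right, sub_self, inner_zero_right, zero_add, add_zero,
    real_inner_eq_sum, Finset.sum_eq_single k] at this
  · simp only [PiLp.sub_apply, Function.update_self] at this
    linarith
  · intro j _ hj
    simp [Function.update_of_ne hj]
  · simp

end

/-! ### Metric subregularity -/

/-- The three polyhedral pieces of the graph of the subdifferential of `α |·|`. -/
def absPiece (α : ℝ) (i : Fin 3) : Set (ℝ × ℝ) :=
  {y | ![1, -1, 1] i * y.1 ≤ 0 ∧ ![-1, -1, 1] i * y.1 ≤ 0 ∧ y.2 ≤ ![α, α, -α] i ∧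
    -y.2 ≤ ![α, -α, α] i}

theorem isClosed_absPiece (α : ℝ) (i : Fin 3) : IsClosed (absPiece α i) := by
  simp only [absPiece, Set.ofPred_and]
  exact (isClosed_le (by fun_prop) (by fun_prop)).inter <|
    (isClosed_le (by fun_prop) (by fun_prop)).inter <|
      (isClosed_le (by fun_prop) (by fun_prop)).inter (isClosed_le (by fun_prop) (by fun_prop))

/-- Index `0` is the vertical segment over `p = 0`, index `1` the ray `p ≥ 0`, `s = α`, and index
`2` the ray `p ≤ 0`, `s = -α`. The rays repeat their sign condition so that all pieces have four
inequalities. -/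
theorem isAbsSubgradient_iff_exists_absPiece {α p s : ℝ} (hα : 0 ≤ α) :
    IsAbsSubgradient α p s ↔ ∃ i, (p, s) ∈ absPiece α i := by
  constructor
  · rintro ⟨h1, h2⟩
    have hs := abs_le.mp h1
    rcases lt_trichotomy p 0 with hp | rfl | hp
    · have h3 : s = -α := by
        rw [abs_of_neg hp] at h2
        exact mul_right_cancel₀ hp.ne (by linarith)
      exact ⟨2, by simp [absPiece, h3, hp.le]⟩
    · exact ⟨0, by simpa [absPiece, neg_le] using hs.symm⟩
    · have h3 : s = α := by
        rw [abs_of_pos hp] at h2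
        exact mul_right_cancel₀ hp.ne' h2
      exact ⟨1, by simp [absPiece, h3, hp.le]⟩
  · rintro ⟨i, h⟩
    fin_cases i <;> simp [absPiece] at h
    · obtain ⟨h1, h2, h3, h4⟩ := h
      obtain rfl := le_antisymm h1 h2
      exact ⟨abs_le.mpr ⟨by linarith, h3⟩, by simp⟩
    · obtain ⟨h1, h3, h4⟩ := h
      obtain rfl := le_antisymm h3 h4
      exact isAbsSubgradient_of_pos hα h1
    · obtain ⟨h1, h3, h4⟩ := h
      obtain rfl := le_antisymm h3 (by linarith)
      exact isAbsSubgradient_of_neg hα h1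

/-- Near `(x₀, x₀')`, only pieces of the graph that contain `(x₀, x₀')` are met. -/
theorem eventually_mem_absPiece {ι κ : Type*} [Fintype κ] (α : ℝ) (x₀ x₀' : KKTSpace ι κ) :
    ∀ᶠ y in 𝓝 (x₀, x₀'), ∀ σ : κ × Fin 2 → Fin 3,
      (∀ k, (y.1.fst.snd k, y.2.fst.snd k + y.1.snd k) ∈ absPiece α (σ k)) →
      ∀ k, (x₀.fst.snd k, x₀'.fst.snd k + x₀.snd k) ∈ absPiece α (σ k) := by
  refine eventually_all.mpr fun σ => ?_
  by_cases hσ : ∀ k, (x₀.fst.snd k, x₀'.fst.snd k + x₀.snd k) ∈ absPiece α (σ k)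
  · exact Eventually.of_forall fun _ _ => hσ
  -- A closed set missing the reference pair misses a neighbourhood of it.
  · have hcl : IsClosed {y : KKTSpace ι κ × KKTSpace ι κ |
        ∀ k, (y.1.fst.snd k, y.2.fst.snd k + y.1.snd k) ∈ absPiece α (σ k)} := by
      simp only [Set.ofPred_forall]
      refine isClosed_iInter fun k => (isClosed_absPiece α (σ k)).preimage ?_
      fun_prop
    filter_upwards [hcl.isOpen_compl.mem_nhds hσ] with y hy h
    exact absurd h hy

section

variable {ι κ τ : Type*} [Fintype ι] [Fintype κ] [Fintype τ]

/-- With the pieces fixed by `σ`, the solutions form a polyhedron, and `x` violates its constraints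
by at most `‖x'‖`: the equations by components of `x'`, the bounds on `lam` by the shift
`x'.fst.snd`, the signs of `p` not at all. -/
theorem exists_kkt_error_bound_of_absPiece (Q : ImageSpace ι →ₗ[ℝ] ImageSpace ι)
    (b : ImageSpace ι) (α : ℝ) (G : ImageSpace ι →ₗ[ℝ] FieldSpace κ) (σ : κ × Fin 2 → Fin 3) :
    ∃ c : ℝ, 0 ≤ c ∧ ∀ z : KKTSpace ι κ,
      Q z.fst.fst - b + LinearMap.adjoint G z.snd = 0 → z.fst.snd - G z.fst.fst = 0 →
      (∀ k, (z.fst.snd k, z.snd k) ∈ absPiece α (σ k)) →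
      ∀ x x' : KKTSpace ι κ, Q x.fst.fst - b + LinearMap.adjoint G x.snd = x'.fst.fst →
      x.fst.snd - G x.fst.fst = x'.snd →
      (∀ k, (x.fst.snd k, x'.fst.snd k + x.snd k) ∈ absPiece α (σ k)) →
      ∃ y : KKTSpace ι κ, Q y.fst.fst - b + LinearMap.adjoint G y.snd = 0 ∧
        y.fst.snd - G y.fst.fst = 0 ∧ (∀ k, (y.fst.snd k, y.snd k) ∈ absPiece α (σ k)) ∧
        ‖x - y‖ ≤ c * ‖x'‖ := by
  let U : KKTSpace ι κ →ₗ[ℝ] ImageSpace ι :=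
    WithLp.fstₗ 2 ℝ (ImageSpace ι) (FieldSpace κ) ∘ₗ WithLp.fstₗ 2 ℝ _ _
  let P : KKTSpace ι κ →ₗ[ℝ] FieldSpace κ :=
    WithLp.sndₗ 2 ℝ (ImageSpace ι) (FieldSpace κ) ∘ₗ WithLp.fstₗ 2 ℝ _ _
  let Λ : KKTSpace ι κ →ₗ[ℝ] FieldSpace κ := WithLp.sndₗ 2 ℝ _ _
  let cI (i : ι) : ImageSpace ι →ₗ[ℝ] ℝ := (EuclideanSpace.proj i).toLinearMap
  let cF (k : κ × Fin 2) : FieldSpace κ →ₗ[ℝ] ℝ := (EuclideanSpace.proj k).toLinearMap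
  obtain ⟨c, hc, h⟩ := exists_error_bound_of_eq_of_le (V := KKTSpace ι κ)
    (Sum.elim (fun i => cI i ∘ₗ (Q ∘ₗ U + LinearMap.adjoint G ∘ₗ Λ))
      fun k => cF k ∘ₗ (P - G ∘ₗ U))
    (Sum.elim (fun i => b i) fun _ => 0)
    (Sum.elim (Sum.elim (fun k => (![1, -1, 1] (σ k) : ℝ) • (cF k ∘ₗ P))
        fun k => (![-1, -1, 1] (σ k) : ℝ) • (cF k ∘ₗ P))
      (Sum.elim (fun k => cF k ∘ₗ Λ) fun k => -(cF k ∘ₗ Λ)))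
    (Sum.elim (Sum.elim (fun _ => 0) fun _ => 0)
      (Sum.elim (fun k => ![α, α, -α] (σ k)) fun k => ![α, -α, α] (σ k)))
  have hI : ∀ y : KKTSpace ι κ, Q y.fst.fst - b + LinearMap.adjoint G y.snd = 0 ↔
      ∀ i, Q y.fst.fst i + LinearMap.adjoint G y.snd i = b i := by
    intro y
    rw [PiLp.ext_iff]
    refine forall_congr' fun i => ?_
    simp only [PiLp.add_apply, PiLp.sub_apply, PiLp.zero_apply]
    constructor <;> intro h <;> linarith
  have hF : ∀ y : KKTSpace ι κ, y.fst.snd - G y.fst.fst = 0 ↔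
      ∀ k, y.fst.snd k - G y.fst.fst k = 0 := fun y => PiLp.ext_iff
  refine ⟨c, hc, fun z hz1 hz2 hz3 x x' hx1 hx2 hx3 => ?_⟩
  have hn1 : ‖x'.fst‖ ≤ ‖x'‖ := WithLp.norm_fst_le _ x'
  have hn2 : ‖x'.snd‖ ≤ ‖x'‖ := WithLp.norm_snd_le _ x'
  have hn3 : ‖x'.fst.fst‖ ≤ ‖x'‖ := (WithLp.norm_fst_le _ x'.fst).trans hn1
  have hn4 : ‖x'.fst.snd‖ ≤ ‖x'‖ := (WithLp.norm_snd_le _ x'.fst).trans hn1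
  have hx4 : ∀ k, |x'.fst.snd k| ≤ ‖x'‖ := fun k => (PiLp.norm_apply_le x'.fst.snd k).trans hn4
  obtain ⟨y, hye, hya, hxy⟩ := h z
    (by
      rintro (i | k)
      · exact (hI z).mp hz1 i
      · exact (hF z).mp hz2 k)
    (by
      rintro ((k | k) | (k | k))
      exacts [(hz3 k).1, (hz3 k).2.1, (hz3 k).2.2.1, (hz3 k).2.2.2])
    x ‖x'‖ (norm_nonneg _)
    (by
      rintro (i | k)
      · have e : Q x.fst.fst i + LinearMap.adjoint G x.snd i - b i = x'.fst.fst i := by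
          rw [← hx1]
          simp only [PiLp.add_apply, PiLp.sub_apply]
          ring
        change |Q x.fst.fst i + LinearMap.adjoint G x.snd i - b i| ≤ _
        rw [e]
        exact (PiLp.norm_apply_le x'.fst.fst i).trans hn3
      · have e : x.fst.snd k - G x.fst.fst k - 0 = x'.snd k := by
          rw [← hx2, sub_zero, PiLp.sub_apply]
        change |x.fst.snd k - G x.fst.fst k - 0| ≤ _
        rw [e]
        exact (PiLp.norm_apply_le x'.snd k).trans hn2)
    (by
      rintro ((k | k) | (k | k))
      · exact (hx3 k).1.trans (add_nonneg le_rfl (norm_nonneg _))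
      · exact (hx3 k).2.1.trans (add_nonneg le_rfl (norm_nonneg _))
      · change x.snd k ≤ ![α, α, -α] (σ k) + ‖x'‖
        have h1 : x'.fst.snd k + x.snd k ≤ _ := (hx3 k).2.2.1
        linarith [neg_le_of_abs_le (hx4 k)]
      · change -x.snd k ≤ ![α, -α, α] (σ k) + ‖x'‖
        have h1 : -(x'.fst.snd k + x.snd k) ≤ _ := (hx3 k).2.2.2
        linarith [le_of_abs_le (hx4 k)])
  exact ⟨y, (hI y).mpr fun i => hye (.inl i), (hF y).mpr fun k => hye (.inr k),
    fun k => ⟨hya (.inl (.inl k)), hya (.inl (.inr k)), hya (.inr (.inl k)),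
      hya (.inr (.inr k))⟩, hxy⟩

theorem kktOperator_metricallySubregular {Q : ImageSpace ι →ₗ[ℝ] ImageSpace ι}
    (hQ : Q.IsPositive) (b : ImageSpace ι) (z : ImageSpace τ) {α : ℝ} (hα : 0 ≤ α)
    (G : ImageSpace ι →ₗ[ℝ] FieldSpace κ) {x₀ : KKTSpace ι κ}
    (hx₀ : 0 ∈ kktOperator Q b z α G x₀) :
    MetricallySubregular (kktOperator Q b z α G) x₀ 0 := by
  refine ⟨hx₀, ?_⟩
  choose c hc h using exists_kkt_error_bound_of_absPiece Q b α G
  obtain ⟨U, hU, V, hV, hUV⟩ := mem_nhds_prod_iff.mp (eventually_mem_absPiece α x₀ 0)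
  obtain ⟨C, hC, hcC⟩ : ∃ C : ℝ, 0 < C ∧ ∀ σ, c σ ≤ C := by
    obtain ⟨σ₀, hσ₀⟩ := Finite.exists_max c
    -- Adding `1` makes `C` positive, so that dividing by it in `ENNReal` is legitimate.
    exact ⟨c σ₀ + 1, by linarith [hc σ₀], fun σ => by linarith [hσ₀ σ]⟩
  have hC' : ENNReal.ofReal C ≠ 0 := (ENNReal.ofReal_pos.mpr hC).ne'
  refine ⟨C.toNNReal, U, hU, V, hV, fun x hx => ?_⟩
  change _ ≤ ENNReal.ofReal C * _
  rw [mul_comm, ← ENNReal.div_le_iff hC' ENNReal.ofReal_ne_top, Metric.le_infEDist]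
  rintro x' ⟨hx', hx'V⟩
  rw [ENNReal.div_le_iff hC' ENNReal.ofReal_ne_top]
  obtain ⟨h1, h2, h3⟩ := (mem_kktOperator_iff hQ b z hα G x x').mp hx'
  obtain ⟨g1, -, g3⟩ := (mem_kktOperator_iff hQ b z hα G x₀ 0).mp hx₀
  choose σ hσ using fun k => (isAbsSubgradient_iff_exists_absPiece hα).mp (h2 k)
  -- The pieces met by `(x, x')` also contain the reference pair, so `x₀` is the feasible point that
  -- Hoffman's bound requires.
  have hσ₀ := hUV (Set.mk_mem_prod hx hx'V) σ hσ
  obtain ⟨y, hy1, hy2, hy3, hxy⟩ := h σ x₀ g1.symm g3.symm (by simpa using hσ₀) x x'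
    h1.symm h3.symm hσ
  have hy : 0 ∈ kktOperator Q b z α G y :=
    (mem_kktOperator_iff hQ b z hα G y 0).mpr ⟨hy1.symm, fun k =>
      (isAbsSubgradient_iff_exists_absPiece hα).mpr ⟨σ k, by simpa using hy3 k⟩, hy2.symm⟩
  calc Metric.infEDist x {w | 0 ∈ kktOperator Q b z α G w} ≤ edist x y :=
        Metric.infEDist_le_edist_of_mem hy
    _ ≤ ENNReal.ofReal (C * ‖x'‖) := by
        rw [edist_dist, dist_eq_norm]
        exact ENNReal.ofReal_le_ofReal
          (hxy.trans (mul_le_mul_of_nonneg_right (hcC σ) (norm_nonneg _)))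
    _ = edist 0 x' * ENNReal.ofReal C := by
        rw [ENNReal.ofReal_mul hC.le, mul_comm, edist_dist, dist_zero_left]

end

/-! ### The discrete image model -/

theorem tvHessian_isPositive {M N : ℕ} {τ : Type*} [Fintype τ] {μ : ℝ} (hμ : 0 ≤ μ)
    (K : ImageSpace (Pixel M N) →ₗ[ℝ] ImageSpace τ) : (tvHessian μ K).IsPositive := by
  -- The two minus signs cancel, leaving a nonnegative combination of Gram operators.
  have : tvHessian μ K = μ • (LinearMap.adjoint (discreteGradient M N) ∘ₗ discreteGradient M N)
      + LinearMap.adjoint K ∘ₗ K := by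
    rw [tvHessian, discreteLaplacian, discreteDiv, LinearMap.neg_comp, neg_smul, smul_neg, neg_neg]
  rw [this]
  exact ((LinearMap.isPositive_adjoint_comp_self _).smul_of_nonneg hμ).add
    (LinearMap.isPositive_adjoint_comp_self _)

/-- Part one treats the general Lagrangian, with `Q` positive semidefinite and any linear `G` in
the place of the gradient; part two is the case of the anisotropic TV regularized problem
`min_u ‖K u - z‖² / 2 + μ / 2 * ‖∇ u‖² + α ‖∇ u‖₁` on a pixel grid, where `Q = -μ Δ + K* K`,
`b = K* z` and `G = ∇` is the discrete gradient. -/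
theorem mainTheorem1 :
    (∀ (ι κ τ : Type) [Fintype ι] [Fintype κ] [Fintype τ]
      (Q : ImageSpace ι →ₗ[ℝ] ImageSpace ι) (b : ImageSpace ι) (z : ImageSpace τ) (α : ℝ)
      (G : ImageSpace ι →ₗ[ℝ] FieldSpace κ),
      Q.IsPositive → 0 < α →
        IsMaximalMonotone (kktOperator Q b z α G) ∧
        ∀ xbar : KKTSpace ι κ, 0 ∈ kktOperator Q b z α G xbar →
          MetricallySubregular (kktOperator Q b z α G) xbar 0) ∧
    (∀ (M N : ℕ) (τ : Type) [Fintype τ]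
      (K : ImageSpace (Pixel M N) →ₗ[ℝ] ImageSpace τ) (z : ImageSpace τ) (μ α : ℝ),
      0 ≤ μ → 0 < α →
        let T := kktOperator (tvHessian μ K) (LinearMap.adjoint K z) z α (discreteGradient M N)
        IsMaximalMonotone T ∧
        ∀ xbar : KKTSpace (Pixel M N) (Pixel M N), 0 ∈ T xbar →
          MetricallySubregular T xbar 0) := by
  refine ⟨fun ι κ τ _ _ _ Q b z α G hQ hα => ⟨kktOperator_isMaximalMonotone hQ b z hα.le G,
    fun xbar hx => kktOperator_metricallySubregular hQ b z hα.le G hx⟩, ?_⟩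
  intro M N τ _ K z μ α hμ hα
  have hQ := tvHessian_isPositive hμ K
  exact ⟨kktOperator_isMaximalMonotone hQ _ z hα.le _,
    fun xbar hx => kktOperator_metricallySubregular hQ _ z hα.le _ hx⟩
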